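/- For a nonempty lattice polytope $P\subset\mathbb R^V$ ($V$ a finite set) of dimension $D=\dim P$ (the dimension of its affine hull), let $h^*(P,x)$ be its $h^*$-polynomial, i.e. the polynomial with $$1+\sum_{m\ge 1}|mP\cap\mathbb Z^V|\,x^m=\frac{h^*(P,x)}{(1-x)^{D+1}} .$$ For $P=\emptyset$ use the same formula with $\dim\emptyset=-1$, so that $h^*(\emptyset,x)=1$. For a finite simple graph $G$ with vertex set $V$, let $\mathcal A_G\subset\mathbb R^V$ be its symmetric edge polytope (of type A), the convex hull of the vectors $\pm(\mathbf e_i-\mathbf e_j)$ for $\{i,j\}\in E(G)$. For an edge $e=\{i,j\}$ of $G$, let $G/e$ be the simple graph obtained from $G$ by deleting $e$, identifying the vertices $i$ and $j$, and merging any multiple edges that arise. Let $G$ be a finite simple bipartite graph and let $e\in E(G)$. Then $$h^*(\mathcal A_G,x)=(x+1)\,h^*(\mathcal A_{G/e},x).$$ -/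

import Mathlib

open scoped Pointwise
open Polynomial

/-- The lattice point enumerator `L_P(m)`: the number of points of `ℤ^V` in the dilate `m P`. -/
noncomputable def latticePointCount {V : Type*} (P : Set (V → ℝ)) (m : ℕ) : ℕ :=
  {z : V → ℤ | (fun v => (z v : ℝ)) ∈ (m : ℝ) • P}.ncard

/-- The Ehrhart series `1 + ∑_{m ≥ 1} L_P(m) x^m`. -/
noncomputable def ehrhartSeries {V : Type*} (P : Set (V → ℝ)) : PowerSeries ℤ :=
  PowerSeries.mk fun m => if m = 0 then 1 else (latticePointCount P m : ℤ)

open Classical in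
/-- `dim P + 1`, where `dim P` is the dimension of the affine hull of `P`
and `dim ∅ = -1`. -/
noncomputable def dimSucc {V : Type*} (P : Set (V → ℝ)) : ℕ :=
  if P.Nonempty then Module.finrank ℝ (vectorSpan ℝ P) + 1 else 0

/-- `h` is the `h^*`-polynomial of `P`: it is a polynomial, and
`Ehr_P(x) = h(x) / (1 - x)^(dim P + 1)` as formal power series. -/
def IsHStarPolynomial {V : Type*} (P : Set (V → ℝ)) (h : ℤ[X]) : Prop :=
  (1 - PowerSeries.X) ^ dimSucc P * ehrhartSeries P = (h : PowerSeries ℤ)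

/-- A set has at most one `h^*`-polynomial. -/
theorem IsHStarPolynomial.unique {V : Type*} {P : Set (V → ℝ)} {h h' : ℤ[X]}
    (H : IsHStarPolynomial P h) (H' : IsHStarPolynomial P h') : h = h' :=
  Polynomial.coe_injective ℤ (Eq.trans (Eq.symm H) H')

open Classical in
/-- The symmetric edge polytope (of type A) of `G`: the convex hull of the vectors
`± (e_i - e_j)` over all edges `{i, j}`. Since adjacency is symmetric, both signs occur. -/
noncomputable def symmetricEdgePolytope {V : Type*} (G : SimpleGraph V) : Set (V → ℝ) :=
  convexHull ℝ {x | ∃ i j, G.Adj i j ∧ x = Pi.single i (1 : ℝ) - Pi.single j (1 : ℝ)}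

/-- The equivalence relation on the vertices that identifies the two ends of `e`
and nothing else. -/
def identifyEnds {V : Type*} (e : Sym2 V) : Setoid V where
  r a b := a = b ∨ (a ∈ e ∧ b ∈ e)
  iseqv :=
    { refl := fun _ => Or.inl rfl
      symm := by
        rintro a b (h | ⟨ha, hb⟩)
        · exact Or.inl h.symm
        · exact Or.inr ⟨hb, ha⟩
      trans := by
        rintro a b c (rfl | ⟨ha, hb⟩) (rfl | ⟨hb', hc⟩)
        · exact Or.inl rfl
        · exact Or.inr ⟨hb', hc⟩
        · exact Or.inr ⟨ha, hb⟩
        · exact Or.inr ⟨ha, hc⟩ }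

/-- The contraction `G / e`: the ends of `e` are identified, `e` (which would become a loop) is
deleted, and parallel edges are merged. -/
def contractEdge {V : Type*} (G : SimpleGraph V) (e : Sym2 V) :
    SimpleGraph (Quotient (identifyEnds e)) where
  Adj p q := p ≠ q ∧ ∃ a b : V,
    Quotient.mk (identifyEnds e) a = p ∧ Quotient.mk (identifyEnds e) b = q ∧ G.Adj a b
  symm := ⟨by
    rintro p q ⟨hpq, a, b, ha, hb, hab⟩
    exact ⟨hpq.symm, b, a, hb, ha, hab.symm⟩⟩
  loopless := ⟨fun _ h => h.1 rfl⟩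

/-! Write a lattice point of the span of the edge vectors as the boundary of a flow with natural
values on the darts of `G`, and let its norm be the least total of such a flow. Integrality of
minimum cost flows identifies the lattice points of `m P` with the vectors of norm at most `m`, so
`(1 - x)` times the Ehrhart series is the generating series of the norm
(`one_sub_X_mul_ehrhartSeries`).

Contracting `e = {i, j}` pushes vectors forward along the vertex quotient, with kernel spanned by `ε
= e_i - e_j`. Over a vector of norm `N` for `G/e`, the least norm is again `N`, attained at some
`z`. Along the line `z + kε` the norm is convex, and since `G` is bipartite its parity alternates
with `k`. So it is at least `N + 1` at `k = ±1`, at least `N + |k|` by convexity, and at most `N +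
|k|` by using `e` itself `|k|` more times (`IsArcContraction.exists_fibre`).

Hence the norm series of `G` is that of `G/e` times `∑_k x^|k| = (1 + x)/(1 - x)`
(`IsArcContraction.normSeries_eq`). The rank drops by exactly one under contraction
(`IsArcContraction.finrank_range`), which absorbs the denominator and leaves the factor `x + 1`.

That `h^*` is a polynomial is proved separately: for a generic weight every lattice vector has a
unique minimum weight flow, whose support is linearly independent, and minimality depends only on
the support. Summing over supports gives a rational function with the right denominator
(`exists_polynomial_normSeries`). -/

/-! ### Circulations and their conformal decomposition. -/

section Flows

variable {V ι : Type*} [Fintype ι] [DecidableEq V]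

/-- The boundary map of a directed multigraph with arcs `ι` from `s d` to `t d`. -/
noncomputable def boundary (R : Type*) [CommRing R] (s t : ι → V) : (ι → R) →ₗ[R] V → R :=
  Fintype.linearCombination R fun d => Pi.single (s d) 1 - Pi.single (t d) 1

theorem boundary_eq_sum {R : Type*} [CommRing R] (s t : ι → V) (f : ι → R) :
    boundary R s t f = ∑ d, f d • (Pi.single (s d) 1 - Pi.single (t d) 1) := by
  simp [boundary, Fintype.linearCombination_apply]

theorem boundary_apply {R : Type*} [CommRing R] (s t : ι → V) (f : ι → R) (v : V) :
    boundary R s t f v =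
      ∑ d, f d * ((if v = s d then 1 else 0) - (if v = t d then 1 else 0)) := by
  simp [boundary_eq_sum, Finset.sum_apply, Pi.single_apply]

theorem boundary_single {R : Type*} [CommRing R] [DecidableEq ι] (s t : ι → V) (d : ι) (r : R) :
    boundary R s t (Pi.single d r) = r • (Pi.single (s d) 1 - Pi.single (t d) 1) := by
  simp [boundary, Fintype.linearCombination_apply_single]

theorem cast_boundary (s t : ι → V) (f : ι → ℤ) (v : V) :
    ((boundary ℤ s t f v : ℤ) : ℝ) = boundary ℝ s t (fun d => (f d : ℝ)) v := by
  simp [boundary_apply]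

/-- Summation by parts: the boundary map is dual to taking differences of potentials. -/
theorem sum_mul_boundary [Fintype V] {R : Type*} [CommRing R] (s t : ι → V) (f : ι → R)
    (p : V → R) : ∑ v, p v * boundary R s t f v = ∑ d, f d * (p (s d) - p (t d)) := by
  simp only [boundary_apply, Finset.mul_sum]
  rw [Finset.sum_comm]
  refine Finset.sum_congr rfl fun d _ => ?_
  simp [mul_sub, Finset.sum_sub_distrib, mul_comm]

/-- `c` takes values in `{-1, 0, 1}` and agrees in sign with `u` on its support. -/
def IsConformal {ι : Type*} (c : ι → ℤ) (u : ι → ℝ) : Prop :=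
  ∀ d, c d = 0 ∨ (c d = 1 ∧ 0 < u d) ∨ (c d = -1 ∧ u d < 0)

theorem IsConformal.abs_le_one {ι : Type*} {c : ι → ℤ} {u : ι → ℝ} (h : IsConformal c u) (d : ι) :
    |c d| ≤ 1 := by
  rcases h d with h | h | h <;> simp [h]

theorem exists_mem_periodicPts {α : Type*} [Finite α] [Nonempty α] (φ : α → α) :
    ∃ x, x ∈ Function.periodicPts φ := by
  obtain ⟨x⟩ := ‹Nonempty α›
  obtain ⟨m, n, hmn, h⟩ := Finite.exists_ne_map_eq_of_infinite fun n : ℕ => φ^[n] x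
  wlog hlt : m < n generalizing m n
  · exact this n m hmn.symm h.symm (by omega)
  refine ⟨φ^[m] x, n - m, by omega, ?_⟩
  change φ^[n - m] (φ^[m] x) = φ^[m] x
  rw [← Function.iterate_add_apply, Nat.sub_add_cancel hlt.le]
  exact h.symm

/-- A nonzero real circulation has a conformal nonzero circulation with values in
`{-1, 0, 1}`. -/
theorem exists_conformal (s t : ι → V) {u : ι → ℝ} (hu : boundary ℝ s t u = 0) (hu0 : u ≠ 0) :
    ∃ c : ι → ℤ, c ≠ 0 ∧ boundary ℤ s t c = 0 ∧ IsConformal c u := by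
  classical
  let A := {d : ι // u d ≠ 0}
  let tail : ι → V := fun d => if 0 < u d then s d else t d
  let head : ι → V := fun d => if 0 < u d then t d else s d
  -- Each arc is reoriented along the sign of `u`, so that `|u|` is a nonnegative circulation from
  -- `tail` to `head`.
  have key : ∀ v, ∑ d, |u d| * ((if v = tail d then 1 else 0) - (if v = head d then 1 else 0))
      = (0 : ℝ) := by
    intro v
    have := congrFun hu v
    rw [boundary_apply, Pi.zero_apply] at this
    refine Eq.trans ?_ this
    refine Finset.sum_congr rfl fun d _ => ?_
    by_cases h : 0 < u d
    · simp [tail, head, h, abs_of_pos h]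
    · simp only [tail, head, h, if_false, abs_of_nonpos (not_lt.1 h)]
      ring
  -- Conservation: if no arc of the support left `head d`, the net flow there would be strictly
  -- negative.
  have hnext : ∀ d : A, ∃ d' : A, tail d' = head d := by
    rintro ⟨d, hd⟩
    by_contra! hno
    have hlt : ∑ d', |u d'| * ((if head d = tail d' then 1 else 0)
        - (if head d = head d' then 1 else 0)) < ∑ d' : ι, (0 : ℝ) := by
      have hz : ∀ d', |u d'| * (if head d = tail d' then (1 : ℝ) else 0) = 0 := by
        intro d'
        by_cases h : u d' = 0
        · simp [h]
        · rw [if_neg fun h' => hno ⟨d', h⟩ h'.symm, mul_zero]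
      apply Finset.sum_lt_sum
      · intro d' _
        rw [mul_sub, hz, zero_sub, neg_nonpos]
        positivity
      · refine ⟨d, Finset.mem_univ _, ?_⟩
        rw [mul_sub, hz, zero_sub, neg_lt_zero]
        simpa using hd
    rw [key] at hlt
    simp at hlt
  choose next hnext using hnext
  have : Nonempty A := by
    obtain ⟨d, hd⟩ := Function.ne_iff.1 hu0
    exact ⟨d, hd⟩
  obtain ⟨x₀, hx₀⟩ := exists_mem_periodicPts next
  let O : Finset A := (Function.periodicPts next).toFinset
  let sgn : ι → ℤ := fun d => if 0 < u d then 1 else -1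
  -- All periodic arcs are taken at once. `next` permutes them, so the sum of tails equals the sum
  -- of heads and the boundary cancels without singling out one cycle.
  let c : ι → ℤ := ∑ x ∈ O, Pi.single (x : ι) (sgn x)
  have hc1 : ∀ x ∈ O, c x = sgn x := by
    intro x hx
    simp only [c, Finset.sum_apply, Pi.single_apply]
    rw [Finset.sum_eq_single x]
    · simp
    · intro y _ hy
      rw [if_neg fun h => hy (Subtype.ext h.symm)]
    · exact fun h => absurd hx h
  have hc0 : ∀ d, (∀ x ∈ O, (x : ι) ≠ d) → c d = 0 := by
    intro d hd
    simp only [c, Finset.sum_apply, Pi.single_apply]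
    exact Finset.sum_eq_zero fun x hx => if_neg fun h => hd x hx h.symm
  have hsgn : ∀ d, sgn d ≠ 0 := by
    intro d
    simp only [sgn]
    split_ifs <;> simp
  refine ⟨c, ?_, ?_, ?_⟩
  · intro h
    have := hc1 x₀ (by simpa [O] using hx₀)
    rw [h] at this
    exact hsgn _ this.symm
  · simp only [c, map_sum, boundary_single]
    have h1 : ∀ x ∈ O, sgn x • ((Pi.single (s x) 1 : V → ℤ) - Pi.single (t x) 1) =
        Pi.single (tail x) 1 - Pi.single (tail (next x)) 1 := by
      intro x _
      rw [hnext]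
      simp only [sgn, tail, head]
      split_ifs <;> simp
    rw [Finset.sum_congr rfl h1, Finset.sum_sub_distrib, sub_eq_zero]
    have hb := Function.bijOn_periodicPts next
    symm
    refine Finset.sum_nbij next ?_ ?_ ?_ fun x _ => rfl
    · intro x hx
      have := hb.mapsTo (by simpa [O] using hx : x ∈ Function.periodicPts next)
      simpa [O] using this
    · simpa [O] using hb.injOn
    · simpa [O] using hb.surjOn
  · intro d
    by_cases h : ∃ x ∈ O, (x : ι) = d
    · obtain ⟨x, hx, rfl⟩ := h
      rw [hc1 x hx]
      by_cases h : 0 < u x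
      · simp [sgn, h]
      · have : u x < 0 := lt_of_le_of_ne (not_lt.1 h) x.2
        simp [sgn, h, this]
    · push Not at h
      exact Or.inl (hc0 d h)

/-- Every real circulation is a nonnegative combination of conformal `{-1, 0, 1}`-valued
circulations, phrased as an induction principle. -/
theorem conformal_induction (s t : ι → V) {P : (ι → ℝ) → Prop} (u : ι → ℝ)
    (hu : boundary ℝ s t u = 0) (h0 : P 0)
    (hadd : ∀ (v : ι → ℝ) (c : ι → ℤ) (a : ℝ), 0 < a → c ≠ 0 → boundary ℤ s t c = 0 →
      IsConformal c u → P v → P (v + a • fun d => (c d : ℝ))) : P u := by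
  classical
  induction h : (Finset.univ.filter fun d => u d ≠ 0).card using Nat.strong_induction_on
    generalizing u with
  | _ n ih =>
  by_cases hu0 : u = 0
  · exact hu0 ▸ h0
  obtain ⟨c, hc0, hcb, hcu⟩ := exists_conformal s t hu hu0
  obtain ⟨d₁, hd₁⟩ := Function.ne_iff.1 hc0
  obtain ⟨d₀, hd₀, hmin⟩ := Finset.exists_min_image (Finset.univ.filter fun d => c d ≠ 0)
    (fun d => |u d|) ⟨d₁, by simpa using hd₁⟩
  have hd₀ : c d₀ ≠ 0 := by simpa using hd₀
  have hmin : ∀ d, c d ≠ 0 → |u d₀| ≤ |u d| := fun d hd => hmin d (by simpa using hd)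
  have hne : ∀ d, c d ≠ 0 → u d ≠ 0 := by
    intro d hd
    rcases hcu d with h | h | h
    · exact absurd h hd
    · exact h.2.ne'
    · exact h.2.ne
  -- The longest step along `c` that flips no sign of `u`: it removes `d₀` from the support and adds
  -- nothing to it, so the support shrinks and conformality to `v` implies conformality to `u`.
  set a := |u d₀| with ha
  have hapos : 0 < a := abs_pos.2 (hne d₀ hd₀)
  set v : ι → ℝ := u - a • fun d => (c d : ℝ) with hv
  have hvd : ∀ d, v d = u d - a * c d := fun d => by simp [hv]
  have hvpos : ∀ d, 0 < v d → 0 < u d := by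
    intro d hd
    rw [hvd] at hd
    rcases hcu d with h | h | h
    · simpa [h] using hd
    · exact h.2
    · have := hmin d (by simp [h])
      rw [abs_of_neg h.2] at this
      rw [h.1] at hd
      push_cast at hd
      linarith
  have hvneg : ∀ d, v d < 0 → u d < 0 := by
    intro d hd
    rw [hvd] at hd
    rcases hcu d with h | h | h
    · simpa [h] using hd
    · have := hmin d (by simp [h])
      rw [abs_of_pos h.2] at this
      rw [h.1] at hd
      push_cast at hd
      linarith
    · exact h.2
  have hv₀ : v d₀ = 0 := by
    rw [hvd]
    rcases hcu d₀ with h | h | h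
    · exact absurd h hd₀
    · rw [ha, abs_of_pos h.2, h.1]
      simp
    · rw [ha, abs_of_neg h.2, h.1]
      simp
  have huv : u = v + a • fun d => (c d : ℝ) := by simp [hv]
  have hcr : boundary ℝ s t (fun d => (c d : ℝ)) = 0 := by
    ext w
    rw [← cast_boundary, hcb]
    simp
  have hPv : P v := by
    refine ih _ ?_ v ?_ ?_ rfl
    · rw [← h]
      refine Finset.card_lt_card (Finset.ssubset_iff_of_subset ?_ |>.2 ⟨d₀, ?_, ?_⟩)
      · intro d hd
        simp only [Finset.mem_filter, Finset.mem_univ, true_and] at hd ⊢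
        rcases lt_or_gt_of_ne hd with hd | hd
        · exact (hvneg d hd).ne
        · exact (hvpos d hd).ne'
      · simpa using hne d₀ hd₀
      · simpa using hv₀
    · rw [hv, map_sub, map_smul, hu, hcr]
      simp
    · intro v' c' a' ha' hc' hb' hcv'
      refine hadd v' c' a' ha' hc' hb' fun d => ?_
      rcases hcv' d with h | h | h
      · exact Or.inl h
      · exact Or.inr (Or.inl ⟨h.1, hvpos d h.2⟩)
      · exact Or.inr (Or.inr ⟨h.1, hvneg d h.2⟩)
  have := hadd v c a hapos hc0 hcb hcu hPv
  rwa [← huv] at this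

end Flows

/-! ### Generic weights, canonical flows and integrality. -/

section Canonical

variable {V ι : Type*} [Fintype ι] [DecidableEq V]

/-- The boundary of a flow with natural number values. -/
noncomputable def natBoundary (s t : ι → V) (f : ι → ℕ) : V → ℤ :=
  boundary ℤ s t fun d => (f d : ℤ)

theorem cast_natBoundary (s t : ι → V) (f : ι → ℕ) :
    (fun v => (natBoundary s t f v : ℝ)) = boundary ℝ s t (fun d => (f d : ℝ)) := by
  ext v
  simp [natBoundary, cast_boundary]

/-- `f` has minimal weight among the natural flows with the same boundary. -/
def IsCanonical (s t : ι → V) (w : ι → ℕ) (f : ι → ℕ) : Prop :=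
  ∀ g : ι → ℕ, natBoundary s t g = natBoundary s t f → ∑ d, f d * w d ≤ ∑ d, g d * w d

/-- No nonzero `{-1, 0, 1}`-vector has weight zero, and the weight refines the coordinate sum. -/
def IsGenericWeight (w : ι → ℕ) : Prop :=
  ∀ c : ι → ℤ, (∀ d, |c d| ≤ 1) → c ≠ 0 → 0 ≤ ∑ d, c d * w d →
    0 < ∑ d, c d * w d ∧ 0 ≤ ∑ d, c d

/-- The weights are `2^n + 2^k` with distinct `k < n`. The common term `2^n` dominates the rest, so
the sign of a nonzero coordinate sum decides the sign of the weight. If the coordinate sum vanishes,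
the distinct powers of two prevent cancellation by uniqueness of binary expansions. -/
theorem exists_isGenericWeight (ι : Type*) [Fintype ι] : ∃ w : ι → ℕ, IsGenericWeight w := by
  classical
  let e := Fintype.equivFin ι
  set n := Fintype.card ι
  have hinj : Function.Injective fun d => (e d : ℕ) :=
    fun a b h => e.injective (Fin.ext h)
  have hpow : ∑ d, (2 : ℤ) ^ (e d : ℕ) < 2 ^ n := by
    have : ∑ d, (2 : ℤ) ^ (e d : ℕ) = ∑ i : Fin n, (2 : ℤ) ^ (i : ℕ) :=
      Equiv.sum_comp e fun i : Fin n => (2 : ℤ) ^ (i : ℕ)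
    rw [this, Fin.sum_univ_eq_sum_range (fun i => (2 : ℤ) ^ i)]
    have h2 : ((∑ k ∈ Finset.range n, 2 ^ k : ℕ) : ℤ) < 2 ^ n := by
      exact_mod_cast Nat.geomSum_lt (le_refl 2) (fun k hk => Finset.mem_range.1 hk)
    simpa using h2
  refine ⟨fun d => 2 ^ n + 2 ^ (e d : ℕ), fun c hc hc0 hnn => ?_⟩
  have hsplit : ∑ d, c d * ((2 ^ n + 2 ^ (e d : ℕ) : ℕ) : ℤ) =
      2 ^ n * ∑ d, c d + ∑ d, c d * 2 ^ (e d : ℕ) := by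
    rw [Finset.mul_sum, ← Finset.sum_add_distrib]
    refine Finset.sum_congr rfl fun d _ => ?_
    push_cast
    ring
  have habs : |∑ d, c d * 2 ^ (e d : ℕ)| < 2 ^ n := by
    refine lt_of_le_of_lt (Finset.abs_sum_le_sum_abs _ _) (lt_of_le_of_lt ?_ hpow)
    refine Finset.sum_le_sum fun d _ => ?_
    rw [abs_mul, abs_of_pos (by positivity : (0 : ℤ) < 2 ^ (e d : ℕ))]
    exact mul_le_of_le_one_left (by positivity) (hc d)
  rw [abs_lt] at habs
  rw [hsplit] at hnn ⊢
  have hpos : (0 : ℤ) < 2 ^ n := by positivity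
  have hsum : 0 ≤ ∑ d, c d := by
    by_contra! h
    nlinarith
  refine ⟨lt_of_le_of_ne hnn fun h0 => hc0 ?_, hsum⟩
  have hsum0 : ∑ d, c d = 0 := by
    refine le_antisymm ?_ hsum
    by_contra! h
    nlinarith
  rw [hsum0, mul_zero, zero_add] at h0
  have hcd : ∀ d, c d = (if c d = 1 then 1 else 0) - (if c d = -1 then 1 else 0) := by
    intro d
    have := abs_le.1 (hc d)
    have : c d = -1 ∨ c d = 0 ∨ c d = 1 := by omega
    rcases this with h | h | h <;> simp [h]
  have hAB : ∑ d with c d = 1, 2 ^ (e d : ℕ) = ∑ d with c d = -1, 2 ^ (e d : ℕ) := by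
    have : ∑ d, c d * 2 ^ (e d : ℕ) = ∑ d with c d = 1, (2 : ℤ) ^ (e d : ℕ)
        - ∑ d with c d = -1, (2 : ℤ) ^ (e d : ℕ) := by
      rw [Finset.sum_filter, Finset.sum_filter, ← Finset.sum_sub_distrib]
      refine Finset.sum_congr rfl fun d _ => ?_
      conv_lhs => rw [hcd d]
      split_ifs <;> simp
    rw [this] at h0
    exact_mod_cast (sub_eq_zero.1 h0.symm)
  have himg : (Finset.univ.filter fun d => c d = 1).image (fun d => (e d : ℕ)) =
      (Finset.univ.filter fun d => c d = -1).image (fun d => (e d : ℕ)) := by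
    apply Finset.geomSum_injective (le_refl 2)
    simp only
    rw [Finset.sum_image hinj.injOn, Finset.sum_image hinj.injOn, hAB]
  have hfil := Finset.image_injective hinj himg
  ext d
  have hd := Finset.ext_iff.1 hfil d
  simp only [Finset.mem_filter, Finset.mem_univ, true_and] at hd
  have h1 := abs_le.1 (hc d)
  simp only [Pi.zero_apply]
  omega

variable {s t : ι → V} {w : ι → ℕ} {f g : ι → ℕ}

theorem exists_isCanonical (s t : ι → V) (w : ι → ℕ) (g : ι → ℕ) :
    ∃ f, natBoundary s t f = natBoundary s t g ∧ IsCanonical s t w f := by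
  classical
  have hex : ∃ n f, natBoundary s t f = natBoundary s t g ∧ ∑ d, f d * w d = n :=
    ⟨_, g, rfl, rfl⟩
  obtain ⟨f, hf, hfn⟩ := Nat.find_spec hex
  refine ⟨f, hf, fun g' hg' => ?_⟩
  rw [hfn]
  exact Nat.find_min' hex ⟨g', hg'.trans hf, rfl⟩

/-- A canonical flow cannot be improved by adding a feasible integral circulation. -/
theorem IsCanonical.weight_nonneg (hf : IsCanonical s t w f) {c : ι → ℤ}
    (hc : boundary ℤ s t c = 0) (hfc : ∀ d, 0 ≤ (f d : ℤ) + c d) :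
    0 ≤ ∑ d, c d * w d := by
  have hcast : ∀ d, ((((f d : ℤ) + c d).toNat : ℕ) : ℤ) = f d + c d :=
    fun d => Int.toNat_of_nonneg (hfc d)
  have hb : natBoundary s t (fun d => ((f d : ℤ) + c d).toNat) = natBoundary s t f := by
    simp only [natBoundary, hcast]
    have : (fun d => (f d : ℤ) + c d) = (fun d => (f d : ℤ)) + c := rfl
    rw [this, map_add, hc, add_zero]
  have := hf _ hb
  have h2 : ((∑ d, f d * w d : ℕ) : ℤ) ≤ ((∑ d, ((f d : ℤ) + c d).toNat * w d : ℕ) : ℤ) :=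
    Int.ofNat_le.2 this
  push_cast at h2
  simp only [Int.natCast_toNat_eq_self.2 (hfc _), add_mul, Finset.sum_add_distrib] at h2
  linarith

/-- Being canonical only depends on the support. -/
theorem IsCanonical.of_support_subset (hf : IsCanonical s t w f)
    (hgf : ∀ d, f d = 0 → g d = 0) : IsCanonical s t w g := by
  intro g' hg'
  have hu : boundary ℝ s t ((fun d => (g' d : ℝ)) - fun d => (g d : ℝ)) = 0 := by
    rw [map_sub, ← cast_natBoundary, ← cast_natBoundary, hg', sub_self]
  -- A conformal piece `c` of `g' - g` is negative only where `g` is positive, hence where `f` is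
  -- positive. So `f + c` is feasible and `c` has nonnegative weight, although `g`, not `f`, is
  -- being compared with `g'`.
  have key := conformal_induction s t (P := fun v => 0 ≤ ∑ d, v d * (w d : ℝ)) _ hu (by simp) ?_
  · simp only [Pi.sub_apply, sub_mul, Finset.sum_sub_distrib, sub_nonneg] at key
    exact_mod_cast key
  · intro v c a ha _ hcb hcu hv
    have h0 : 0 ≤ ∑ d, c d * w d := by
      refine hf.weight_nonneg hcb fun d => ?_
      rcases hcu d with h | h | ⟨h, h'⟩
      · simp [h]
      · simp only [h.1]
        positivity
      · have h1 : (g' d : ℝ) < g d := by simpa using h'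
        have h2 : g' d < g d := by exact_mod_cast h1
        have h3 : f d ≠ 0 := fun h0 => by
          have := hgf d h0
          omega
        omega
    have h1 : (0 : ℝ) ≤ ∑ d, (c d : ℝ) * w d := by exact_mod_cast h0
    simp only [Pi.add_apply, Pi.smul_apply, smul_eq_mul, add_mul, Finset.sum_add_distrib,
      mul_assoc, ← Finset.mul_sum]
    positivity

/-- A canonical flow has minimal total even among real flows. -/
theorem IsCanonical.sum_le (hw : IsGenericWeight w) (hf : IsCanonical s t w f) {l : ι → ℝ}
    (hl : ∀ d, 0 ≤ l d) (h : boundary ℝ s t l = fun v => (natBoundary s t f v : ℝ)) :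
    ((∑ d, f d : ℕ) : ℝ) ≤ ∑ d, l d := by
  have hu : boundary ℝ s t (l - fun d => (f d : ℝ)) = 0 := by
    rw [map_sub, ← cast_natBoundary, h, sub_self]
  have key := conformal_induction s t (P := fun v => 0 ≤ ∑ d, v d) _ hu (by simp) ?_
  · simpa [Finset.sum_sub_distrib] using key
  · intro v c a ha hc0 hcb hcu hv
    have h0 : 0 ≤ ∑ d, c d * w d := by
      refine hf.weight_nonneg hcb fun d => ?_
      rcases hcu d with h | h | ⟨h, h'⟩
      · simp [h]
      · simp only [h.1]
        positivity
      · have h1 : l d < f d := by simpa using h'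
        have h2 : (0 : ℝ) < f d := (hl d).trans_lt h1
        have h3 : 0 < f d := by exact_mod_cast h2
        omega
    have h1 : (0 : ℝ) ≤ ∑ d, (c d : ℝ) := by
      exact_mod_cast (hw c (fun d => hcu.abs_le_one d) hc0 h0).2
    simp only [Pi.add_apply, Pi.smul_apply, smul_eq_mul, Finset.sum_add_distrib,
      ← Finset.mul_sum]
    positivity

/-- Every conformal piece of `g - f` is feasible for `f`, so by genericity its weight is strictly
positive. Unless `f = g`, this makes `g` strictly heavier than `f`. -/
theorem IsCanonical.eq_of_natBoundary_eq (hw : IsGenericWeight w) (hf : IsCanonical s t w f)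
    (hg : IsCanonical s t w g) (h : natBoundary s t f = natBoundary s t g) : f = g := by
  have hu : boundary ℝ s t ((fun d => (g d : ℝ)) - fun d => (f d : ℝ)) = 0 := by
    rw [map_sub, ← cast_natBoundary, ← cast_natBoundary, h, sub_self]
  have key := conformal_induction s t (P := fun v => v = 0 ∨ 0 < ∑ d, v d * (w d : ℝ)) _ hu
    (Or.inl rfl) ?_
  · rcases key with key | key
    · ext d
      have := congrFun key d
      simp only [Pi.sub_apply, Pi.zero_apply, sub_eq_zero] at this
      exact_mod_cast this.symm
    · simp only [Pi.sub_apply, sub_mul, Finset.sum_sub_distrib, sub_pos] at key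
      have h1 : ∑ d, f d * w d < ∑ d, g d * w d := by exact_mod_cast key
      exact absurd (hg f h) (not_le.2 h1)
  · intro v c a ha hc0 hcb hcu hv
    have h0 : 0 ≤ ∑ d, c d * w d := by
      refine hf.weight_nonneg hcb fun d => ?_
      rcases hcu d with h | h | ⟨h, h'⟩
      · simp [h]
      · simp only [h.1]
        positivity
      · have h1 : (g d : ℝ) < f d := by simpa using h'
        have h2 : g d < f d := by exact_mod_cast h1
        omega
    have h1 : (0 : ℝ) < ∑ d, (c d : ℝ) * w d := by
      exact_mod_cast (hw c (fun d => hcu.abs_le_one d) hc0 h0).1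
    right
    simp only [Pi.add_apply, Pi.smul_apply, smul_eq_mul, add_mul, Finset.sum_add_distrib,
      mul_assoc, ← Finset.mul_sum]
    have h2 : 0 ≤ ∑ d, v d * (w d : ℝ) := by
      rcases hv with rfl | hv
      · simp
      · exact hv.le
    positivity

/-- The arcs in the support of a canonical flow form a signed forest. -/
theorem IsCanonical.eq_zero_of_boundary_eq_zero (hw : IsGenericWeight w)
    (hf : IsCanonical s t w f) {u : ι → ℝ} (hu : boundary ℝ s t u = 0)
    (huf : ∀ d, f d = 0 → u d = 0) : u = 0 := by
  refine conformal_induction s t (P := fun v => v = 0) u hu rfl ?_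
  intro v c a ha hc0 hcb hcu hv
  exfalso
  have hfc : ∀ d, f d = 0 → c d = 0 := by
    intro d hd
    have := huf d hd
    rcases hcu d with h | h | h
    · exact h
    · exact absurd this h.2.ne'
    · exact absurd this h.2.ne
  -- Since `c` lives on the support of `f` with entries at most one in absolute value, both `c` and
  -- `-c` can be added to `f`. Both weights are then nonnegative, against genericity.
  have habs := hcu.abs_le_one
  have h1 : 0 ≤ ∑ d, c d * w d := by
    refine hf.weight_nonneg hcb fun d => ?_
    have := abs_le.1 (habs d)
    have := hfc d
    omega
  have h2 : 0 ≤ ∑ d, (-c) d * w d := by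
    refine hf.weight_nonneg (by rw [map_neg, hcb, neg_zero]) fun d => ?_
    have := abs_le.1 (habs d)
    have := hfc d
    simp only [Pi.neg_apply]
    omega
  have h3 := (hw c habs hc0 h1).1
  simp only [Pi.neg_apply, neg_mul, Finset.sum_neg_distrib] at h2
  linarith

/-- The boundaries of the arcs in the support are linearly independent. The bound lets one power of
`1 - x`, with exponent the rank, clear all denominators of the norm series. -/
theorem IsCanonical.card_support_le [Finite V] (hw : IsGenericWeight w)
    (hf : IsCanonical s t w f) :
    (Finset.univ.filter fun d => f d ≠ 0).card ≤
      Module.finrank ℝ (LinearMap.range (boundary ℝ s t)) := by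
  classical
  set S := Finset.univ.filter fun d => f d ≠ 0 with hS
  have hli : LinearIndependent ℝ fun d : S =>
      (⟨boundary ℝ s t (Pi.single (d : ι) 1), LinearMap.mem_range_self _ _⟩ :
        LinearMap.range (boundary ℝ s t)) := by
    rw [Fintype.linearIndependent_iff]
    intro a ha d
    have ha' : boundary ℝ s t (∑ d : S, a d • Pi.single (d : ι) 1) = 0 := by
      have := congrArg Subtype.val ha
      simpa using this
    have hval : ∀ d' : S, (∑ d : S, a d • Pi.single (d : ι) (1 : ℝ) : ι → ℝ) d' = a d' := by
      intro d'
      simp only [Finset.sum_apply, Pi.smul_apply, Pi.single_apply, smul_eq_mul]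
      rw [Finset.sum_eq_single d']
      · simp
      · intro y _ hy
        rw [if_neg fun h => hy (Subtype.ext h.symm), mul_zero]
      · simp
    rw [← hval, hf.eq_zero_of_boundary_eq_zero hw ha']
    · rfl
    · intro d' hd'
      simp only [Finset.sum_apply, Pi.smul_apply, Pi.single_apply, smul_eq_mul]
      refine Finset.sum_eq_zero fun x _ => ?_
      rw [if_neg, mul_zero]
      rintro rfl
      exact (Finset.mem_filter.1 x.2).2 hd'
  simpa using hli.fintype_card_le_finrank

/-- An integral vector in the real span of a reversible family of arcs is the boundary of a
natural flow. -/
theorem exists_natBoundary_eq [Fintype V] (σ : ι ≃ ι) (hσ : ∀ d, s (σ d) = t d ∧ t (σ d) = s d)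
    {l : ι → ℝ} {z : V → ℤ} (h : boundary ℝ s t l = fun v => (z v : ℝ)) :
    ∃ f, natBoundary s t f = z := by
  let M : AddSubgroup (V → ℤ) :=
    { carrier := {z | ∃ f, natBoundary s t f = z}
      add_mem' := by
        rintro _ _ ⟨f, rfl⟩ ⟨g, rfl⟩
        refine ⟨f + g, ?_⟩
        simp only [natBoundary, ← map_add]
        congr 1
      zero_mem' := ⟨0, by simp [natBoundary, boundary_eq_sum]⟩
      neg_mem' := by
        rintro _ ⟨f, rfl⟩
        refine ⟨f ∘ σ, ?_⟩
        ext v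
        simp only [natBoundary, boundary_apply, Function.comp, Pi.neg_apply]
        rw [← Equiv.sum_comp σ fun d =>
          (f d : ℤ) * ((if v = s d then 1 else 0) - (if v = t d then 1 else 0)),
          ← Finset.sum_neg_distrib]
        refine Finset.sum_congr rfl fun d _ => ?_
        rw [(hσ d).1, (hσ d).2, ← mul_neg, neg_sub] }
  change z ∈ M
  -- Two vertices are related when their difference is an integral boundary; this contains
  -- connectivity along arcs.
  let r : Setoid V :=
    { r := fun a b => (Pi.single a 1 - Pi.single b 1 : V → ℤ) ∈ M
      iseqv :=
        { refl := fun a => by simp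
          symm := fun {a b} hab => by simpa using M.neg_mem hab
          trans := fun {a b c} hab hbc => by simpa using M.add_mem hab hbc } }
  classical
  have hclass : ∀ q : Quotient r, ∑ v, (if Quotient.mk r v = q then (1 : ℤ) else 0) * z v = 0 := by
    intro q
    have hd : ∀ d, Quotient.mk r (s d) = Quotient.mk r (t d) := by
      intro d
      refine Quotient.sound ⟨Pi.single d 1, ?_⟩
      have : (fun d' => ((Pi.single d 1 : ι → ℕ) d' : ℤ)) = Pi.single d 1 := by
        ext d'
        simp [Pi.single_apply]
      rw [natBoundary, this, boundary_single, one_smul]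
    -- The indicator of a class is a potential that is constant along every arc, so it pairs to zero
    -- with any real boundary.
    have h1 := sum_mul_boundary s t l fun v => if Quotient.mk r v = q then (1 : ℝ) else 0
    rw [h] at h1
    simp only [hd, sub_self, mul_zero, Finset.sum_const_zero] at h1
    have h2 : ((∑ v, (if Quotient.mk r v = q then (1 : ℤ) else 0) * z v : ℤ) : ℝ) = 0 := by
      push_cast
      exact h1
    exact_mod_cast h2
  -- As `z` sums to zero on each class, subtracting its mass at the class representatives changes
  -- nothing.
  have hz : z = ∑ v, z v • (Pi.single v 1 - Pi.single (Quotient.mk r v).out 1 : V → ℤ) := by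
    have h0 : ∑ v, z v • (Pi.single (Quotient.mk r v).out 1 : V → ℤ) = 0 := by
      rw [← Finset.sum_fiberwise (s := Finset.univ) (g := fun v => Quotient.mk r v)]
      refine Finset.sum_eq_zero fun q _ => ?_
      have : ∀ v ∈ Finset.univ.filter (fun v => Quotient.mk r v = q),
          z v • (Pi.single (Quotient.mk r v).out 1 : V → ℤ) = z v • Pi.single q.out 1 := by
        intro v hv
        rw [(Finset.mem_filter.1 hv).2]
      rw [Finset.sum_congr rfl this, ← Finset.sum_smul, Finset.sum_filter]
      have := hclass q
      simp only [ite_mul, one_mul, zero_mul] at this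
      rw [this, zero_smul]
    simp only [smul_sub, Finset.sum_sub_distrib, h0, sub_zero]
    ext v
    simp [Finset.sum_apply, Pi.single_apply]
  rw [hz]
  refine M.sum_mem fun v _ => M.zsmul_mem ?_ _
  exact Setoid.symm (Quotient.mk_out v)

/-- Integrality of minimum cost flows. -/
theorem exists_natBoundary_eq_and_sum_le [Fintype V] (σ : ι ≃ ι)
    (hσ : ∀ d, s (σ d) = t d ∧ t (σ d) = s d)
    {l : ι → ℝ} (hl : ∀ d, 0 ≤ l d) {z : V → ℤ} (h : boundary ℝ s t l = fun v => (z v : ℝ)) :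
    ∃ f, natBoundary s t f = z ∧ ((∑ d, f d : ℕ) : ℝ) ≤ ∑ d, l d := by
  obtain ⟨w, hw⟩ := exists_isGenericWeight ι
  obtain ⟨g, hg⟩ := exists_natBoundary_eq σ hσ h
  obtain ⟨f, hfg, hf⟩ := exists_isCanonical s t w g
  refine ⟨f, hfg.trans hg, hf.sum_le hw hl ?_⟩
  rw [h, hfg, hg]

end Canonical

/-! ### The generating series of the flow norm and its rationality. -/

section NormSeries

variable {V ι : Type*} [Fintype ι] [DecidableEq V]

/-- `n` is the least total of a natural flow with boundary `z`. -/
def IsFlowNorm (s t : ι → V) (z : V → ℤ) (n : ℕ) : Prop :=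
  IsLeast {n | ∃ f, natBoundary s t f = z ∧ ∑ d, f d = n} n

/-- The generating series of the flow norm on the lattice spanned by the arcs. -/
noncomputable def normSeries (s t : ι → V) : PowerSeries ℤ :=
  PowerSeries.mk fun m => ({z | IsFlowNorm s t z m}.ncard : ℤ)

variable {s t : ι → V}

theorem exists_isFlowNorm (f : ι → ℕ) :
    ∃ n ≤ ∑ d, f d, IsFlowNorm s t (natBoundary s t f) n := by
  classical
  have hex : ∃ n g, natBoundary s t g = natBoundary s t f ∧ ∑ d, g d = n := ⟨_, f, rfl, rfl⟩
  exact ⟨Nat.find hex, Nat.find_min' hex ⟨f, rfl, rfl⟩, Nat.find_spec hex,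
    fun n hn => Nat.find_min' hex hn⟩

theorem finite_sum_eq (ι : Type*) [Fintype ι] (m : ℕ) : {f : ι → ℕ | ∑ d, f d = m}.Finite := by
  classical
  refine (Finset.finite_toSet (Fintype.piFinset fun _ : ι => Finset.range (m + 1))).subset ?_
  intro f hf
  have hf : ∑ d, f d = m := hf
  simp only [Finset.mem_coe, Fintype.mem_piFinset, Finset.mem_range]
  intro d
  have := Finset.single_le_sum (fun d _ => Nat.zero_le (f d)) (Finset.mem_univ d)
  omega

theorem finite_isFlowNorm (s t : ι → V) (m : ℕ) : {z | IsFlowNorm s t z m}.Finite := by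
  refine ((finite_sum_eq ι m).image (natBoundary s t)).subset ?_
  rintro z ⟨⟨f, hf, hfm⟩, -⟩
  exact ⟨f, hfm, hf⟩

variable {w : ι → ℕ}

theorem IsCanonical.isFlowNorm (hw : IsGenericWeight w) {f : ι → ℕ} (hf : IsCanonical s t w f) :
    IsFlowNorm s t (natBoundary s t f) (∑ d, f d) := by
  refine ⟨⟨f, rfl, rfl⟩, ?_⟩
  rintro n ⟨g, hg, rfl⟩
  have := hf.sum_le hw (l := fun d => (g d : ℝ)) (fun d => by positivity)
    (by rw [← hg, cast_natBoundary])
  exact_mod_cast this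

/-- Each vector in the lattice has exactly one canonical flow, and its total is the norm because the
generic weight refines the total. -/
theorem ncard_isFlowNorm (hw : IsGenericWeight w) (s t : ι → V) (m : ℕ) :
    {z | IsFlowNorm s t z m}.ncard = {f | IsCanonical s t w f ∧ ∑ d, f d = m}.ncard := by
  symm
  refine Set.ncard_congr (fun f _ => natBoundary s t f) ?_ ?_ ?_
  · rintro f ⟨hf, rfl⟩
    exact hf.isFlowNorm hw
  · rintro f g ⟨hf, -⟩ ⟨hg, -⟩ h
    exact hf.eq_of_natBoundary_eq hw hg h
  · rintro z hz
    obtain ⟨g, rfl, hgm⟩ := hz.1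
    obtain ⟨f, hfg, hf⟩ := exists_isCanonical s t w g
    refine ⟨f, ⟨hf, ?_⟩, hfg⟩
    exact (hfg ▸ hf.isFlowNorm hw).unique hz

/-- Flows with prescribed support are counted by a power of `x / (1 - x)`. -/
theorem coeff_prod_card_support [DecidableEq ι] (S : Finset ι) (m : ℕ) :
    PowerSeries.coeff m (∏ _d ∈ S, PowerSeries.mk fun n => if n = 0 then (0 : ℤ) else 1) =
      {f : ι → ℕ | (Finset.univ.filter fun d => f d ≠ 0) = S ∧ ∑ d, f d = m}.ncard := by
  rw [PowerSeries.coeff_prod]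
  simp only [PowerSeries.coeff_mk]
  have h1 : ∀ l : ι →₀ ℕ, ∏ i ∈ S, (if l i = 0 then (0 : ℤ) else 1) =
      if ∀ i ∈ S, l i ≠ 0 then 1 else 0 := by
    intro l
    split_ifs with h
    · exact Finset.prod_eq_one fun i hi => if_neg (h i hi)
    · push Not at h
      obtain ⟨i, hi, h0⟩ := h
      exact Finset.prod_eq_zero hi (if_pos h0)
  simp only [h1]
  rw [Finset.sum_boole, ← Set.ncard_coe_finset]
  congr 1
  refine Set.ncard_congr (fun l _ => ⇑l) ?_ ?_ ?_
  · intro l hl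
    simp only [Finset.coe_filter, Finset.mem_finsuppAntidiag, Set.mem_ofPred_eq] at hl ⊢
    obtain ⟨⟨hsum, hsub⟩, hS⟩ := hl
    have : (Finset.univ.filter fun d => l d ≠ 0) = S := by
      ext d
      simp only [Finset.mem_filter, Finset.mem_univ, true_and]
      exact ⟨fun h => hsub (Finsupp.mem_support_iff.2 h), fun h => hS d h⟩
    refine ⟨this, ?_⟩
    rw [← hsum, ← this, Finset.sum_filter_ne_zero]
  · intro l l' _ _ h
    exact DFunLike.coe_injective h
  · rintro f ⟨hS, hm⟩
    refine ⟨Finsupp.equivFunOnFinite.symm f, ?_, by simp⟩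
    simp only [Finset.coe_filter, Finset.mem_finsuppAntidiag, Set.mem_ofPred_eq]
    refine ⟨⟨?_, ?_⟩, ?_⟩
    · rw [← hm, ← hS]
      simp [Finset.sum_filter_ne_zero]
    · intro d hd
      rw [← hS]
      simpa using hd
    · intro d hd
      rw [← hS] at hd
      simpa using hd

theorem one_sub_X_mul_mk_ite :
    (1 - PowerSeries.X) * (PowerSeries.mk fun n => if n = 0 then (0 : ℤ) else 1) =
      PowerSeries.X := by
  ext n
  rw [sub_mul, one_mul, map_sub, PowerSeries.coeff_mk, PowerSeries.coeff_X]
  cases n with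
  | zero => simp
  | succ n =>
    rw [PowerSeries.coeff_succ_X_mul, PowerSeries.coeff_mk]
    by_cases h : n = 0 <;> simp [h]

/-- The norm series is a rational function with denominator a power of `1 - x`. -/
theorem exists_polynomial_normSeries [Finite V] (s t : ι → V) :
    ∃ h : ℤ[X], (1 - PowerSeries.X) ^ Module.finrank ℝ (LinearMap.range (boundary ℝ s t)) *
      normSeries s t = (h : PowerSeries ℤ) := by
  classical
  obtain ⟨w, hw⟩ := exists_isGenericWeight ι
  set r := Module.finrank ℝ (LinearMap.range (boundary ℝ s t))
  let supp : (ι → ℕ) → Finset ι := fun f => Finset.univ.filter fun d => f d ≠ 0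
  -- The supports of canonical flows play the part of the simplices of a unimodular triangulation,
  -- the empty support included.
  let Δ : Finset (Finset ι) := Finset.univ.filter fun S => ∃ f, IsCanonical s t w f ∧ supp f = S
  have hN : normSeries s t =
      ∑ S ∈ Δ, ∏ _d ∈ S, PowerSeries.mk fun n => if n = 0 then (0 : ℤ) else 1 := by
    ext m
    rw [map_sum, normSeries, PowerSeries.coeff_mk, ncard_isFlowNorm hw]
    simp only [coeff_prod_card_support]
    rw [← Nat.cast_sum]
    congr 1
    have hfin : ∀ P : (ι → ℕ) → Prop, {f | P f ∧ ∑ d, f d = m}.Finite :=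
      fun P => (finite_sum_eq ι m).subset fun f hf => hf.2
    rw [Set.ncard_eq_toFinset_card _ (hfin _), Finset.card_eq_sum_card_fiberwise (f := supp)
      (t := Δ)]
    · refine Finset.sum_congr rfl fun S hS => ?_
      rw [← Set.ncard_coe_finset]
      congr 1
      ext f
      obtain ⟨f₀, hf₀, hf₀S⟩ := (Finset.mem_filter.1 hS).2
      simp only [Finset.coe_filter, Set.Finite.mem_toFinset, Set.mem_ofPred_eq]
      constructor
      · rintro ⟨⟨_, h1⟩, h2⟩
        exact ⟨h2, h1⟩
      · rintro ⟨h2, h1⟩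
        -- One canonical flow with support `S` makes every flow with support `S` canonical, so each
        -- `S` contributes the full `(x / (1 - x))^|S|`.
        refine ⟨⟨hf₀.of_support_subset fun d hd => ?_, h1⟩, h2⟩
        have := Finset.ext_iff.1 (hf₀S.trans h2.symm) d
        simp only [supp, Finset.mem_filter, Finset.mem_univ, true_and] at this
        tauto
    · intro f hf
      simp only [Set.Finite.coe_toFinset, Set.mem_ofPred_eq] at hf
      simp only [Δ, Finset.coe_filter, Finset.mem_univ, true_and, Set.mem_ofPred_eq]
      exact ⟨f, hf.1, rfl⟩
  -- The usual passage from face numbers to the `h`-polynomial; truncated subtraction is harmless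
  -- because `|S| ≤ r`.
  refine ⟨∑ S ∈ Δ, (1 - X) ^ (r - S.card) * X ^ S.card, ?_⟩
  rw [hN, Finset.mul_sum, ← Polynomial.coeToPowerSeries.ringHom_apply, map_sum]
  refine Finset.sum_congr rfl fun S hS => ?_
  obtain ⟨f, hf, rfl⟩ := (Finset.mem_filter.1 hS).2
  have hle : (supp f).card ≤ r := hf.card_support_le hw
  rw [Finset.prod_const, ← Nat.sub_add_cancel hle, pow_add, mul_assoc, ← mul_pow,
    one_sub_X_mul_mk_ite]
  simp

end NormSeries

/-! ### From lattice points of the polytope to the flow norm. -/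

section Polytope

variable {V : Type*} [DecidableEq V] (G : SimpleGraph V) [Fintype G.Dart]

/-- The boundary map of the darts of a graph. -/
noncomputable abbrev dartBoundary : (G.Dart → ℝ) →ₗ[ℝ] V → ℝ :=
  boundary ℝ (fun d : G.Dart => d.fst) fun d => d.snd

/-- Reversal of darts. -/
def dartReverse : G.Dart ≃ G.Dart :=
  SimpleGraph.Dart.symm_involutive.toPerm

theorem symmetricEdgePolytope_eq_image_stdSimplex :
    symmetricEdgePolytope G = dartBoundary G '' stdSimplex ℝ G.Dart := by
  classical
  rw [← convexHull_rangle_single_eq_stdSimplex, LinearMap.image_convexHull, symmetricEdgePolytope]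
  congr 1
  ext x
  constructor
  · rintro ⟨i, j, hij, rfl⟩
    refine ⟨_, ⟨⟨(i, j), hij⟩, rfl⟩, ?_⟩
    rw [boundary_single, one_smul]
    congr!
  · rintro ⟨_, ⟨d, rfl⟩, rfl⟩
    refine ⟨d.fst, d.snd, d.adj, ?_⟩
    rw [boundary_single, one_smul]
    congr!

variable {G}

/-- A dart and its reverse cancel, so the origin lies in the polytope as soon as there is an edge.
This is the circulation used for padding flows of too small a total. -/
theorem exists_stdSimplex_dartBoundary_eq_zero (d : G.Dart) :
    ∃ l ∈ stdSimplex ℝ G.Dart, dartBoundary G l = 0 := by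
  classical
  refine ⟨(2⁻¹ : ℝ) • Pi.single d 1 + (2⁻¹ : ℝ) • Pi.single d.symm 1, ?_, ?_⟩
  · exact convex_stdSimplex ℝ G.Dart (single_mem_stdSimplex ℝ d) (single_mem_stdSimplex ℝ d.symm)
      (by norm_num) (by norm_num) (by norm_num)
  · simp only [map_add, map_smul, boundary_single, one_smul]
    simp [← smul_add]

theorem cast_mem_smul_symmetricEdgePolytope_iff [Fintype V] (d : G.Dart) (m : ℕ) (z : V → ℤ) :
    (fun v => (z v : ℝ)) ∈ (m : ℝ) • symmetricEdgePolytope G ↔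
      ∃ f : G.Dart → ℕ, natBoundary (fun d : G.Dart => d.fst) (fun d => d.snd) f = z ∧
        ∑ d, f d ≤ m := by
  rw [symmetricEdgePolytope_eq_image_stdSimplex]
  constructor
  · rintro ⟨_, ⟨l, hl, rfl⟩, hz⟩
    -- A point of `m P` is the boundary of a real flow of total `m`; integrality replaces it by a
    -- natural flow of no larger total.
    obtain ⟨f, hf, hfl⟩ := exists_natBoundary_eq_and_sum_le (dartReverse G)
      (s := fun d : G.Dart => d.fst) (t := fun d => d.snd) (fun d => ⟨rfl, rfl⟩)
      (l := (m : ℝ) • l) (fun d => mul_nonneg (by positivity) (hl.1 d)) (z := z)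
      (by rw [map_smul]; exact hz)
    refine ⟨f, hf, ?_⟩
    simp only [Pi.smul_apply, smul_eq_mul, ← Finset.mul_sum, hl.2, mul_one] at hfl
    exact_mod_cast hfl
  · rintro ⟨f, rfl, hfm⟩
    obtain ⟨l, hl, hl0⟩ := exists_stdSimplex_dartBoundary_eq_zero d
    rcases Nat.eq_zero_or_pos m with rfl | hm
    · have hf : ∀ d, f d = 0 := by simpa using hfm
      refine ⟨0, ⟨l, hl, hl0⟩, ?_⟩
      ext v
      simp [natBoundary, boundary_apply, hf]
    · have hm' : (0 : ℝ) < m := by exact_mod_cast hm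
      have hfm' : ∑ d, (f d : ℝ) ≤ m := by exact_mod_cast hfm
      -- The missing total `m - ∑ f` is put on the circulation `l`, which leaves the boundary
      -- unchanged.
      let l' : G.Dart → ℝ := (fun d => (f d : ℝ)) + (m - ∑ d, (f d : ℝ)) • l
      refine ⟨_, ⟨(m : ℝ)⁻¹ • l', ⟨fun d => ?_, ?_⟩, rfl⟩, ?_⟩
      · simp only [l', Pi.smul_apply, Pi.add_apply, smul_eq_mul]
        have := mul_nonneg (sub_nonneg.2 hfm') (hl.1 d)
        positivity
      · simp only [l', Pi.smul_apply, Pi.add_apply, smul_eq_mul, ← Finset.mul_sum,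
          Finset.sum_add_distrib, hl.2, mul_one, add_sub_cancel]
        exact inv_mul_cancel₀ hm'.ne'
      · change (m : ℝ) • dartBoundary G _ = _
        rw [map_smul, smul_smul, mul_inv_cancel₀ hm'.ne', one_smul, map_add, map_smul, hl0,
          smul_zero, add_zero, cast_natBoundary]

theorem latticePointCount_eq [Fintype V] (d : G.Dart) (m : ℕ) :
    latticePointCount (symmetricEdgePolytope G) m =
      {z | ∃ n ≤ m, IsFlowNorm (fun d : G.Dart => d.fst) (fun d => d.snd) z n}.ncard := by
  rw [latticePointCount]
  congr 1
  ext z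
  rw [Set.mem_ofPred_eq, cast_mem_smul_symmetricEdgePolytope_iff d, Set.mem_ofPred_eq]
  constructor
  · rintro ⟨f, rfl, hfm⟩
    obtain ⟨n, hn, h⟩ := exists_isFlowNorm (s := fun d : G.Dart => d.fst) (t := fun d => d.snd) f
    exact ⟨n, hn.trans hfm, h⟩
  · rintro ⟨n, hn, ⟨f, hf, rfl⟩, -⟩
    exact ⟨f, hf, hn⟩

theorem isFlowNorm_zero_iff {V ι : Type*} [Fintype ι] [DecidableEq V] {s t : ι → V} {z : V → ℤ} :
    IsFlowNorm s t z 0 ↔ z = 0 := by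
  constructor
  · rintro ⟨⟨f, rfl, hf⟩, -⟩
    have hf : ∀ d, f d = 0 := by simpa using hf
    ext v
    simp [natBoundary, boundary_apply, hf]
  · rintro rfl
    refine ⟨⟨0, ?_, by simp⟩, fun n _ => Nat.zero_le n⟩
    ext v
    simp [natBoundary, boundary_apply]

/-- Multiplication by `1 - x` takes successive differences, which turns the number of vectors of
norm at most `m` into the number of norm exactly `m`. -/
theorem one_sub_X_mul_ehrhartSeries [Fintype V] (d : G.Dart) :
    (1 - PowerSeries.X) * ehrhartSeries (symmetricEdgePolytope G) =
      normSeries (fun d : G.Dart => d.fst) fun d => d.snd := by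
  -- The constant term, set to `1` by convention, agrees with the true count: only the origin has
  -- norm `0`.
  have hL : ehrhartSeries (symmetricEdgePolytope G) =
      PowerSeries.mk fun m => (latticePointCount (symmetricEdgePolytope G) m : ℤ) := by
    ext m
    rw [ehrhartSeries, PowerSeries.coeff_mk, PowerSeries.coeff_mk]
    split_ifs with h
    · rw [h, latticePointCount_eq d]
      simp [isFlowNorm_zero_iff]
    · rfl
  rw [hL]
  ext m
  rw [sub_mul, one_mul, map_sub, normSeries]
  cases m with
  | zero => simp [latticePointCount_eq d, isFlowNorm_zero_iff]
  | succ m =>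
    simp only [PowerSeries.coeff_succ_X_mul, PowerSeries.coeff_mk, latticePointCount_eq d]
    set s : G.Dart → V := fun d => d.fst
    set t : G.Dart → V := fun d => d.snd
    have hU : {z | ∃ n ≤ m + 1, IsFlowNorm s t z n} =
        {z | ∃ n ≤ m, IsFlowNorm s t z n} ∪ {z | IsFlowNorm s t z (m + 1)} := by
      ext z
      simp only [Set.mem_ofPred_eq, Set.mem_union]
      constructor
      · rintro ⟨n, hn, h⟩
        rcases Nat.le_succ_iff.1 hn with hn | rfl
        · exact Or.inl ⟨n, hn, h⟩
        · exact Or.inr h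
      · rintro (⟨n, hn, h⟩ | h)
        · exact ⟨n, hn.trans (Nat.le_succ m), h⟩
        · exact ⟨m + 1, le_rfl, h⟩
    have hfin : {z | ∃ n ≤ m, IsFlowNorm s t z n}.Finite := by
      refine ((Set.finite_Iic m).biUnion fun n _ => finite_isFlowNorm s t n).subset ?_
      rintro z ⟨n, hn, h⟩
      exact Set.mem_biUnion (Set.mem_Iic.2 hn) h
    rw [hU, Set.ncard_union_eq _ hfin (finite_isFlowNorm s t _)]
    · push_cast
      ring
    · rw [Set.disjoint_left]
      rintro z ⟨n, hn, h⟩ h'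
      have := IsLeast.unique h h'
      omega

theorem vectorSpan_symmetricEdgePolytope (d : G.Dart) :
    vectorSpan ℝ (symmetricEdgePolytope G) = LinearMap.range (dartBoundary G) := by
  classical
  obtain ⟨l, hl, hl0⟩ := exists_stdSimplex_dartBoundary_eq_zero d
  have h0 : (0 : V → ℝ) ∈ symmetricEdgePolytope G := by
    rw [symmetricEdgePolytope_eq_image_stdSimplex]
    exact ⟨l, hl, hl0⟩
  rw [vectorSpan_eq_span_vsub_set_right ℝ h0]
  simp only [vsub_eq_sub, sub_zero, Set.image_id']
  rw [symmetricEdgePolytope_eq_image_stdSimplex]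
  apply le_antisymm
  · rw [Submodule.span_le]
    rintro _ ⟨l, -, rfl⟩
    exact LinearMap.mem_range_self _ _
  · rintro _ ⟨l, rfl⟩
    rw [pi_eq_sum_univ' l, map_sum]
    refine Submodule.sum_mem _ fun d _ => ?_
    rw [map_smul]
    refine Submodule.smul_mem _ _ (Submodule.subset_span ⟨_, ?_, rfl⟩)
    convert single_mem_stdSimplex ℝ d using 1

theorem one_sub_X_pow_mul_ehrhartSeries [Fintype V] :
    (1 - PowerSeries.X) ^ dimSucc (symmetricEdgePolytope G) *
        ehrhartSeries (symmetricEdgePolytope G) =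
      (1 - PowerSeries.X) ^ Module.finrank ℝ (LinearMap.range (dartBoundary G)) *
        normSeries (fun d : G.Dart => d.fst) fun d => d.snd := by
  classical
  -- An edgeless graph has empty polytope and `dimSucc = 0`, and both sides equal `1`. This case
  -- does occur, for `G/e` when `e` is the only edge.
  rcases isEmpty_or_nonempty G.Dart with hE | ⟨⟨d⟩⟩
  · have hP : symmetricEdgePolytope G = ∅ := by
      rw [symmetricEdgePolytope_eq_image_stdSimplex]
      simp [stdSimplex]
    have hE' : ehrhartSeries (∅ : Set (V → ℝ)) = 1 := by
      ext m
      simp [ehrhartSeries, latticePointCount, PowerSeries.coeff_one]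
    have hN : normSeries (fun d : G.Dart => d.fst) (fun d => d.snd) = 1 := by
      ext m
      rw [normSeries, PowerSeries.coeff_mk, PowerSeries.coeff_one]
      split_ifs with h
      · simp [h, isFlowNorm_zero_iff]
      · rw [Nat.cast_eq_zero]
        have : {z | IsFlowNorm (fun d : G.Dart => d.fst) (fun d => d.snd) z m} = ∅ := by
          refine Set.eq_empty_of_forall_notMem ?_
          rintro z ⟨⟨f, -, hf⟩, -⟩
          exact h (by simpa using hf.symm)
        rw [this, Set.ncard_empty]
    have hr : Module.finrank ℝ (LinearMap.range (dartBoundary G)) = 0 := by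
      rw [Submodule.finrank_eq_zero, LinearMap.range_eq_bot]
      exact Subsingleton.elim _ _
    rw [hP, hE', hN, hr]
    simp [dimSucc]
  · have hne : (symmetricEdgePolytope G).Nonempty := by
      obtain ⟨l, hl, hl0⟩ := exists_stdSimplex_dartBoundary_eq_zero d
      rw [symmetricEdgePolytope_eq_image_stdSimplex]
      exact ⟨_, l, hl, hl0⟩
    rw [dimSucc, if_pos hne, vectorSpan_symmetricEdgePolytope d, pow_succ, mul_assoc,
      one_sub_X_mul_ehrhartSeries d]

end Polytope

/-! ### Pushforward along a vertex map, parity and growth of the norm. -/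

section Pushforward

variable {V W ι κ : Type*} [Fintype ι] [Fintype κ] [Fintype V] [DecidableEq W]

/-- The pushforward of vectors along a map of the index sets, summing over the fibres. -/
noncomputable def pushforward (R : Type*) [CommRing R] (q : V → W) : (V → R) →ₗ[R] W → R :=
  Fintype.linearCombination R fun v => Pi.single (q v) 1

theorem pushforward_single [DecidableEq V] {R : Type*} [CommRing R] (q : V → W) (v : V) :
    pushforward R q (Pi.single v 1) = Pi.single (q v) 1 := by
  simp [pushforward, Fintype.linearCombination_apply_single]

theorem pushforward_apply {R : Type*} [CommRing R] (q : V → W) (z : V → R) (w : W) :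
    pushforward R q z w = ∑ v, if w = q v then z v else 0 := by
  simp [pushforward, Fintype.linearCombination_apply, Finset.sum_apply, Pi.single_apply]

variable [DecidableEq V]

theorem pushforward_boundary {R : Type*} [CommRing R] (q : V → W) (s t : ι → V) (f : ι → R) :
    pushforward R q (boundary R s t f) = boundary R (q ∘ s) (q ∘ t) f := by
  simp [boundary_eq_sum, pushforward_single]

omit [Fintype V] in
theorem natBoundary_add_single [DecidableEq ι] (s t : ι → V) (f : ι → ℕ) (d : ι) (n : ℕ) :
    natBoundary s t (f + Pi.single d n) =
      natBoundary s t f + (n : ℤ) • (Pi.single (s d) 1 - Pi.single (t d) 1) := by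
  rw [natBoundary, natBoundary, ← boundary_single, ← map_add]
  congr 1
  ext d'
  simp only [Pi.add_apply, Nat.cast_add, Pi.single_apply]
  split_ifs <;> simp

omit [Fintype V] in
/-- A flow can be transported to another family of arcs that contains a parallel copy of
every arc that is not a loop. -/
theorem exists_natBoundary_eq_of_parallel {s t : ι → V} {s' t' : κ → V}
    (h : ∀ d, s d = t d ∨ ∃ k, s' k = s d ∧ t' k = t d) (f : ι → ℕ) :
    ∃ g : κ → ℕ, natBoundary s' t' g = natBoundary s t f ∧ ∑ k, g k ≤ ∑ d, f d := by
  classical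
  suffices ∀ S : Finset ι, ∃ g : κ → ℕ, natBoundary s' t' g =
      ∑ d ∈ S, (f d : ℤ) • (Pi.single (s d) 1 - Pi.single (t d) 1) ∧ ∑ k, g k ≤ ∑ d ∈ S, f d by
    obtain ⟨g, hg, hgf⟩ := this Finset.univ
    exact ⟨g, by rw [hg, natBoundary, boundary_eq_sum], hgf⟩
  intro S
  induction S using Finset.induction_on with
  | empty =>
    refine ⟨0, ?_, by simp⟩
    ext v
    simp [natBoundary, boundary_apply]
  | insert d S hd ih =>
    obtain ⟨g, hg, hgf⟩ := ih
    rw [Finset.sum_insert hd, Finset.sum_insert hd]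
    rcases h d with h | ⟨k, hs, ht⟩
    · exact ⟨g, by rw [hg, h, sub_self, smul_zero, zero_add], by omega⟩
    · refine ⟨g + Pi.single k (f d), ?_, ?_⟩
      · rw [natBoundary_add_single, hg, hs, ht, add_comm]
      · simp only [Pi.add_apply, Finset.sum_add_distrib, Finset.sum_pi_single', Finset.mem_univ,
          if_true]
        omega

omit [Fintype V] in
theorem range_boundary_le_of_parallel {R : Type*} [CommRing R] {s t : ι → V} {s' t' : κ → V}
    (h : ∀ d, s d = t d ∨ ∃ k, s' k = s d ∧ t' k = t d) :
    LinearMap.range (boundary R s t) ≤ LinearMap.range (boundary R s' t') := by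
  classical
  rintro _ ⟨f, rfl⟩
  rw [boundary_eq_sum]
  refine Submodule.sum_mem _ fun d _ => Submodule.smul_mem _ _ ?_
  rcases h d with h | ⟨k, hs, ht⟩
  · rw [h, sub_self]
    exact Submodule.zero_mem _
  · exact ⟨Pi.single k 1, by rw [boundary_single, one_smul, hs, ht]⟩

/-- If all arcs change the parity of a potential, the total of a flow is determined modulo two
by its boundary. -/
theorem natBoundary_parity {s t : ι → V} {p : V → ℤ} (hp : ∀ d, Odd (p (s d) - p (t d)))
    {f g : ι → ℕ} (h : natBoundary s t f = natBoundary s t g) :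
    ∑ d, f d ≡ ∑ d, g d [MOD 2] := by
  -- Pairing the boundary with `p` weights every arc by an odd number, so modulo two it returns the
  -- total of the flow.
  have key : ∀ f : ι → ℕ, ((∑ d, f d : ℕ) : ZMod 2) =
      ((∑ v, p v * natBoundary s t f v : ℤ) : ZMod 2) := by
    intro f
    rw [natBoundary, sum_mul_boundary]
    push_cast
    refine Finset.sum_congr rfl fun d _ => ?_
    have : ((p (s d) - p (t d) : ℤ) : ZMod 2) = 1 := (ZMod.intCast_eq_one_iff_odd).2 (hp d)
    push_cast at this
    rw [this, mul_one]
  rw [← ZMod.natCast_eq_natCast_iff, key, key, h]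

/-- Moving `n` steps along the direction of an arc away from a flow norm minimizer of a fibre
raises the flow norm by at least `n`. -/
theorem add_le_sum_of_natBoundary_eq {s t : ι → V} (σ : ι ≃ ι)
    (hσ : ∀ d, s (σ d) = t d ∧ t (σ d) = s d) {p : V → ℤ}
    (hp : ∀ d, Odd (p (s d) - p (t d))) {q : V → W} {d₀ : ι} (hd₀ : q (s d₀) = q (t d₀))
    {f₀ : ι → ℕ} (hmin : ∀ f, pushforward ℤ q (natBoundary s t f) =
      pushforward ℤ q (natBoundary s t f₀) → ∑ d, f₀ d ≤ ∑ d, f d)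
    {n : ℕ} {f : ι → ℕ} (hf : natBoundary s t f = natBoundary s t f₀ +
      (n : ℤ) • (Pi.single (s d₀) 1 - Pi.single (t d₀) 1)) :
    ∑ d, f₀ d + n ≤ ∑ d, f d := by
  classical
  have hε : pushforward ℤ q (Pi.single (s d₀) 1 - Pi.single (t d₀) 1) = 0 := by
    rw [map_sub, pushforward_single, pushforward_single, hd₀, sub_self]
  rcases Nat.eq_zero_or_pos n with rfl | hn
  · refine hmin f ?_
    rw [hf, map_add, map_smul, hε, smul_zero, add_zero]
  · have hn' : (0 : ℝ) < n := by exact_mod_cast hn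
    have hn1 : (1 : ℝ) ≤ n := by exact_mod_cast hn
    -- Convexity of the norm: the average of one copy of `f` and `n - 1` copies of `f₀` is a real
    -- flow with boundary one step away from that of `f₀`. It is then rounded to a natural flow
    -- `f₁`.
    let l : ι → ℝ := (n : ℝ)⁻¹ • ((fun d => (f d : ℝ)) + ((n : ℝ) - 1) • fun d => (f₀ d : ℝ))
    have hl : boundary ℝ s t l = fun v => (((natBoundary s t f₀ +
        (Pi.single (s d₀) 1 - Pi.single (t d₀) 1) : V → ℤ) v : ℤ) : ℝ) := by
      simp only [l, map_smul, map_add]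
      rw [← cast_natBoundary, ← cast_natBoundary, hf]
      ext v
      simp only [Pi.smul_apply, Pi.add_apply, smul_eq_mul]
      push_cast
      field_simp
      ring
    obtain ⟨f₁, hf₁, hf₁l⟩ := exists_natBoundary_eq_and_sum_le σ hσ (l := l) (fun d => by
      simp only [l, Pi.smul_apply, Pi.add_apply, smul_eq_mul]
      have := mul_nonneg (sub_nonneg.2 hn1) (Nat.cast_nonneg (α := ℝ) (f₀ d))
      positivity) hl
    have h1 : ∑ d, f₀ d ≤ ∑ d, f₁ d := hmin f₁ (by rw [hf₁, map_add, hε, add_zero])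
    -- `f₁` has the same boundary as `f₀` with one more unit on `d₀`, so its total has the opposite
    -- parity to that of `f₀`. Being no smaller, it is larger by at least one.
    have h2 : ∑ d, f₁ d ≡ ∑ d, (f₀ + Pi.single d₀ 1 : ι → ℕ) d [MOD 2] := by
      refine natBoundary_parity hp ?_
      rw [hf₁, natBoundary_add_single, Nat.cast_one, one_smul]
    simp only [Pi.add_apply, Finset.sum_add_distrib, Finset.sum_pi_single', Finset.mem_univ,
      if_true] at h2
    have h3 : ∑ d, f₀ d + 1 ≤ ∑ d, f₁ d := by
      rcases h1.eq_or_lt with h | h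
      · rw [← h] at h2
        unfold Nat.ModEq at h2
        omega
      · exact h
    simp only [l, Pi.smul_apply, Pi.add_apply, smul_eq_mul, ← Finset.mul_sum,
      Finset.sum_add_distrib] at hf₁l
    have h4 : (n : ℝ) * (∑ d, f₁ d : ℕ) ≤ ∑ d, (f d : ℝ) + (n - 1) * ∑ d, (f₀ d : ℝ) := by
      rwa [← le_inv_mul_iff₀ hn']
    have h5 : (n : ℝ) * ((∑ d, f₀ d : ℕ) + 1) ≤ (n : ℝ) * (∑ d, f₁ d : ℕ) := by
      gcongr
      exact_mod_cast h3
    have h6 : ((∑ d, f₀ d + n : ℕ) : ℝ) ≤ (∑ d, f d : ℕ) := by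
      push_cast at h4 h5 ⊢
      linarith
    exact_mod_cast h6

end Pushforward

/-! ### Contraction of an arc and the product formula. -/

section Contraction

variable {V W ι κ : Type*} [Fintype ι] [Fintype κ] [Fintype V] [DecidableEq V] [DecidableEq W]

/-- If `q` identifies exactly `i` and `j`, the kernel of its pushforward is spanned by
`e_i - e_j`. -/
theorem eq_smul_of_pushforward_eq_zero {R : Type*} [CommRing R] {q : V → W} {i j : V}
    (hij : i ≠ j) (hq : ∀ a b, q a = q b ↔ a = b ∨ ((a = i ∨ a = j) ∧ (b = i ∨ b = j)))
    {z : V → R} (hz : pushforward R q z = 0) :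
    z = z i • (Pi.single i 1 - Pi.single j 1) := by
  have hz' : ∀ v, ∑ u, (if q v = q u then z u else 0) = 0 := fun v => by
    rw [← pushforward_apply, hz, Pi.zero_apply]
  ext v
  by_cases hv : v = i ∨ v = j
  · have h0 : z i + z j = 0 := by
      rw [← hz' i, ← Finset.add_sum_erase _ _ (Finset.mem_univ i), if_pos rfl,
        ← Finset.add_sum_erase _ _ (Finset.mem_erase.2 ⟨hij.symm, Finset.mem_univ j⟩),
        if_pos ((hq i j).2 (Or.inr ⟨Or.inl rfl, Or.inr rfl⟩)), Finset.sum_eq_zero, add_zero]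
      intro u hu
      simp only [Finset.mem_erase] at hu
      refine if_neg fun h => ?_
      rcases (hq i u).1 h with h | ⟨-, h | h⟩
      · exact hu.2.1 h.symm
      · exact hu.2.1 h
      · exact hu.1 h
    rcases hv with rfl | rfl
    · simp [hij]
    · simp [hij.symm, eq_neg_of_add_eq_zero_right h0]
  · have := hz' v
    rw [Finset.sum_eq_single v] at this
    · rw [if_pos rfl] at this
      push Not at hv
      simp [this, hv.1, hv.2]
    · intro u _ hu
      refine if_neg fun h => ?_
      rcases (hq v u).1 h with h | h
      · exact hu h.symm
      · exact hv h.1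
    · simp

/-- The family of arcs `s' t'` arises from `s t` by contracting the arc `d₀`. -/
structure IsArcContraction (s t : ι → V) (s' t' : κ → W) (q : V → W) (d₀ : ι) : Prop where
  ne : s d₀ ≠ t d₀
  eq_iff : ∀ a b, q a = q b ↔ a = b ∨ ((a = s d₀ ∨ a = t d₀) ∧ (b = s d₀ ∨ b = t d₀))
  push : ∀ d, q (s d) = q (t d) ∨ ∃ k, s' k = q (s d) ∧ t' k = q (t d)
  lift : ∀ k, ∃ d, q (s d) = s' k ∧ q (t d) = t' k

variable {s t : ι → V} {s' t' : κ → W} {q : V → W} {d₀ : ι}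

omit [Fintype ι] [Fintype κ] [Fintype V] [DecidableEq V] [DecidableEq W] in
theorem IsArcContraction.map_eq (h : IsArcContraction s t s' t' q d₀) :
    q (s d₀) = q (t d₀) :=
  (h.eq_iff _ _).2 (Or.inr ⟨Or.inl rfl, Or.inr rfl⟩)

/-- Rank and nullity for the pushforward restricted to the boundaries: its image is the boundary
space of the contraction, and its kernel is the line spanned by the boundary of `d₀`. -/
theorem IsArcContraction.finrank_range (h : IsArcContraction s t s' t' q d₀) :
    Module.finrank ℝ (LinearMap.range (boundary ℝ s t)) =
      Module.finrank ℝ (LinearMap.range (boundary ℝ s' t')) + 1 := by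
  classical
  set Q := (pushforward ℝ q).domRestrict (LinearMap.range (boundary ℝ s t)) with hQ
  have hr : LinearMap.range Q = LinearMap.range (boundary ℝ s' t') := by
    have h1 : LinearMap.range Q = LinearMap.range (boundary ℝ (q ∘ s) (q ∘ t)) := by
      ext x
      constructor
      · rintro ⟨⟨_, f, rfl⟩, rfl⟩
        exact ⟨f, (pushforward_boundary q s t f).symm⟩
      · rintro ⟨f, rfl⟩
        exact ⟨⟨_, f, rfl⟩, pushforward_boundary q s t f⟩
    rw [h1]
    exact le_antisymm (range_boundary_le_of_parallel h.push)
      (range_boundary_le_of_parallel fun k => Or.inr (h.lift k))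
  have hk : Module.finrank ℝ (LinearMap.ker Q) = 1 := by
    have hmem : (Pi.single (s d₀) 1 - Pi.single (t d₀) 1 : V → ℝ) ∈
        LinearMap.range (boundary ℝ s t) :=
      ⟨Pi.single d₀ 1, by rw [boundary_single, one_smul]⟩
    have hker : Subtype.mk _ hmem ∈ LinearMap.ker Q := by
      rw [LinearMap.mem_ker, hQ, LinearMap.domRestrict_apply, map_sub, pushforward_single,
        pushforward_single, h.map_eq, sub_self]
    have hspan : LinearMap.ker Q = Submodule.span ℝ {Subtype.mk _ hmem} := by
      refine le_antisymm ?_ ?_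
      · rintro ⟨x, hx⟩ hx'
        refine Submodule.mem_span_singleton.2 ⟨x (s d₀), ?_⟩
        ext1
        exact (eq_smul_of_pushforward_eq_zero h.ne h.eq_iff hx').symm
      · rwa [Submodule.span_le, Set.singleton_subset_iff]
    rw [hspan]
    refine finrank_span_singleton fun h0 => ?_
    have h1 := congrFun (congrArg Subtype.val h0) (s d₀)
    simp [h.ne] at h1
  rw [← LinearMap.finrank_range_add_finrank_ker Q, hr, hk]

/-- Over each lattice vector of the contraction, the flow norm is a shifted absolute value. -/
theorem IsArcContraction.exists_fibre (h : IsArcContraction s t s' t' q d₀) (σ : ι ≃ ι)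
    (hσ : ∀ d, s (σ d) = t d ∧ t (σ d) = s d) {p : V → ℤ}
    (hp : ∀ d, Odd (p (s d) - p (t d))) {x : W → ℤ} {N : ℕ} (hx : IsFlowNorm s' t' x N) :
    ∃ z, pushforward ℤ q z = x ∧ ∀ k : ℤ,
      IsFlowNorm s t (z + k • (Pi.single (s d₀) 1 - Pi.single (t d₀) 1)) (N + k.natAbs) := by
  classical
  have hpush : ∀ f, natBoundary (q ∘ s) (q ∘ t) f = pushforward ℤ q (natBoundary s t f) :=
    fun f => (pushforward_boundary q s t _).symm
  obtain ⟨g, hg, hgN⟩ := hx.1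
  -- A minimal flow of the contraction lifts arc by arc without raising its total, and conversely
  -- every flow pushes down, losing loops. So `f₀` has the least total over the whole fibre.
  obtain ⟨f₀, hf₀, hf₀g⟩ := exists_natBoundary_eq_of_parallel (s' := q ∘ s) (t' := q ∘ t)
    (fun k => Or.inr (h.lift k)) g
  rw [hpush, hg] at hf₀
  have hmin : ∀ f, pushforward ℤ q (natBoundary s t f) = x → N ≤ ∑ d, f d := by
    intro f hf
    obtain ⟨g', hg', hg'f⟩ := exists_natBoundary_eq_of_parallel (s := q ∘ s) (t := q ∘ t)
      h.push f
    exact (hx.2 ⟨g', by rw [hg', hpush, hf], rfl⟩).trans hg'f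
  have hf₀N : ∑ d, f₀ d = N := le_antisymm (hf₀g.trans hgN.le) (hmin f₀ hf₀)
  have key : ∀ d, q (s d) = q (t d) → ∀ n : ℕ, IsFlowNorm s t
      (natBoundary s t f₀ + (n : ℤ) • (Pi.single (s d) 1 - Pi.single (t d) 1)) (N + n) := by
    intro d hd n
    constructor
    · refine ⟨f₀ + Pi.single d n, natBoundary_add_single s t f₀ d n, ?_⟩
      simp only [Pi.add_apply, Finset.sum_add_distrib, Finset.sum_pi_single', Finset.mem_univ,
        if_true, hf₀N]
    · rintro _ ⟨f, hf, rfl⟩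
      have := add_le_sum_of_natBoundary_eq σ hσ hp hd (f₀ := f₀)
        (fun f hf => hf₀N.trans_le (hmin f (hf.trans hf₀))) hf
      rwa [hf₀N] at this
  refine ⟨natBoundary s t f₀, hf₀, fun k => ?_⟩
  obtain ⟨n, rfl | rfl⟩ := Int.eq_nat_or_neg k
  · exact key d₀ h.map_eq n
  -- Negative multiples of the direction are positive multiples for the reversed arc.
  · have := key (σ d₀) (by rw [(hσ d₀).1, (hσ d₀).2, h.map_eq]) n
    rw [(hσ d₀).1, (hσ d₀).2, ← neg_sub, smul_neg, ← neg_smul] at this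
    rwa [Int.natAbs_neg, Int.natAbs_natCast]

/-- The generating series of the absolute value on `ℤ` is `(1 + x) / (1 - x)`. -/
theorem one_sub_X_mul_mk_ncard_natAbs :
    (1 - PowerSeries.X) * (PowerSeries.mk fun b => ({k : ℤ | k.natAbs = b}.ncard : ℤ)) =
      1 + PowerSeries.X := by
  have hc : ∀ b, ({k : ℤ | k.natAbs = b}.ncard : ℤ) = if b = 0 then 1 else 2 := by
    intro b
    have hset : {k : ℤ | k.natAbs = b} = {(b : ℤ), -(b : ℤ)} := by
      ext k
      simp only [Set.mem_ofPred_eq, Set.mem_insert_iff, Set.mem_singleton_iff]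
      omega
    rw [hset]
    split_ifs with hb
    · simp [hb]
    · rw [Set.ncard_pair (by omega)]
      rfl
  simp only [hc]
  ext n
  rw [sub_mul, one_mul, map_sub, map_add, PowerSeries.coeff_mk, PowerSeries.coeff_X,
    PowerSeries.coeff_one]
  cases n with
  | zero => simp
  | succ n =>
    rw [PowerSeries.coeff_succ_X_mul, PowerSeries.coeff_mk]
    by_cases h : n = 0 <;> simp [h]

/-- With a minimal lift `z₀ x` chosen in each fibre, `(x, k) ↦ z₀ x + k • ε` is a bijection onto the
lattice that adds the norm of `x` and `|k|`. -/
theorem IsArcContraction.normSeries_eq (h : IsArcContraction s t s' t' q d₀) (σ : ι ≃ ι)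
    (hσ : ∀ d, s (σ d) = t d ∧ t (σ d) = s d) {p : V → ℤ}
    (hp : ∀ d, Odd (p (s d) - p (t d))) :
    normSeries s t = normSeries s' t' *
      PowerSeries.mk fun b => ({k : ℤ | k.natAbs = b}.ncard : ℤ) := by
  classical
  set ε : V → ℤ := Pi.single (s d₀) 1 - Pi.single (t d₀) 1 with hε
  have hεi : ε (s d₀) = 1 := by simp [hε, h.ne]
  have hqε : pushforward ℤ q ε = 0 := by
    rw [hε, map_sub, pushforward_single, pushforward_single, h.map_eq, sub_self]
  have hfib : ∀ x : W → ℤ, ∃ z, ∀ N, IsFlowNorm s' t' x N → pushforward ℤ q z = x ∧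
      ∀ k : ℤ, IsFlowNorm s t (z + k • ε) (N + k.natAbs) := by
    intro x
    by_cases hx : ∃ N, IsFlowNorm s' t' x N
    · obtain ⟨N, hN⟩ := hx
      obtain ⟨z, hz⟩ := h.exists_fibre σ hσ hp hN
      refine ⟨z, fun N' hN' => ?_⟩
      rwa [IsLeast.unique hN' hN]
    · exact ⟨0, fun N hN => absurd ⟨N, hN⟩ hx⟩
  choose z₀ hz₀ using hfib
  have hfinZ : ∀ b : ℕ, {k : ℤ | k.natAbs = b}.Finite := by
    intro b
    refine (Set.finite_Icc (-(b : ℤ)) b).subset fun k hk => ?_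
    have hk : k.natAbs = b := hk
    rw [Set.mem_Icc]
    omega
  ext m
  rw [PowerSeries.coeff_mul]
  simp only [normSeries, PowerSeries.coeff_mk]
  have hcount : ∀ ab : ℕ × ℕ, ({x | IsFlowNorm s' t' x ab.1}.ncard : ℤ) *
      ({k : ℤ | k.natAbs = ab.2}.ncard : ℤ) =
      (((finite_isFlowNorm s' t' ab.1).toFinset ×ˢ (hfinZ ab.2).toFinset).card : ℤ) := by
    intro ab
    rw [Finset.card_product, Set.ncard_eq_toFinset_card _ (finite_isFlowNorm s' t' ab.1),
      Set.ncard_eq_toFinset_card _ (hfinZ ab.2), Nat.cast_mul]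
  simp only [hcount]
  rw [← Nat.cast_sum, ← Finset.card_sigma, Set.ncard_eq_toFinset_card _ (finite_isFlowNorm s t m)]
  congr 1
  symm
  refine Finset.card_nbij (fun y => z₀ y.2.1 + y.2.2 • ε) ?_ ?_ ?_
  · rintro ⟨⟨a, b⟩, x, k⟩ hy
    simp only [Finset.mem_coe, Finset.mem_sigma, Finset.mem_product,
      Set.Finite.mem_toFinset, Set.mem_ofPred_eq] at hy ⊢
    obtain ⟨hab, hx, rfl⟩ := hy
    obtain rfl := Finset.HasAntidiagonal.mem_antidiagonal.1 hab
    exact (hz₀ x a hx).2 k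
  · rintro ⟨⟨a, b⟩, x, k⟩ hy ⟨⟨a', b'⟩, x', k'⟩ hy' heq
    simp only [Finset.mem_coe, Finset.mem_sigma, Finset.mem_product,
      Set.Finite.mem_toFinset, Set.mem_ofPred_eq] at hy hy' heq
    obtain ⟨-, hx, rfl⟩ := hy
    obtain ⟨-, hx', rfl⟩ := hy'
    have hxx : x = x' := by
      have := congrArg (pushforward ℤ q) heq
      rwa [map_add, map_add, map_smul, map_smul, hqε, smul_zero, smul_zero, add_zero, add_zero,
        (hz₀ x a hx).1, (hz₀ x' a' hx').1] at this
    subst hxx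
    have hkk : k = k' := by
      -- The coordinate at `s d₀` recovers `k`, as `ε` has value `1` there.
      have := congrFun (add_left_cancel heq) (s d₀)
      simpa [hεi] using this
    subst hkk
    rw [IsLeast.unique hx hx']
  · intro z hz
    simp only [Set.Finite.coe_toFinset, Set.mem_ofPred_eq] at hz
    obtain ⟨f, hf, -⟩ := hz.1
    obtain ⟨g, hg, -⟩ := exists_natBoundary_eq_of_parallel (s := q ∘ s) (t := q ∘ t) h.push f
    have hg : natBoundary s' t' g = pushforward ℤ q z := by
      rw [hg, ← hf]
      exact (pushforward_boundary q s t _).symm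
    obtain ⟨N, -, hN⟩ := exists_isFlowNorm (s := s') (t := t') g
    rw [hg] at hN
    obtain ⟨hz₁, hz₂⟩ := hz₀ _ N hN
    have hzk := eq_smul_of_pushforward_eq_zero h.ne h.eq_iff
      (z := z - z₀ (pushforward ℤ q z)) (by rw [map_sub, hz₁, sub_self])
    set k := (z - z₀ (pushforward ℤ q z)) (s d₀)
    have hzz : z₀ (pushforward ℤ q z) + k • ε = z := by
      rw [← hzk, add_sub_cancel]
    refine ⟨⟨(N, k.natAbs), pushforward ℤ q z, k⟩, ?_, hzz⟩
    simp only [Finset.mem_coe, Finset.mem_sigma, Finset.mem_product,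
      Set.Finite.mem_toFinset, Set.mem_ofPred_eq, and_true]
    refine ⟨?_, hN⟩
    have := hz₂ k
    rw [hzz] at this
    exact Finset.HasAntidiagonal.mem_antidiagonal.2 (IsLeast.unique this hz)

/-- Merging parallel edges does no harm: `push` only asks for some arc between the image vertices,
and darts that become loops fall under its first alternative. -/
theorem isArcContraction_contractEdge {V : Type*} {G : SimpleGraph V} {i j : V}
    (hij : G.Adj i j) :
    IsArcContraction (fun d : G.Dart => d.fst) (fun d => d.snd)
      (fun d : (contractEdge G s(i, j)).Dart => d.fst) (fun d => d.snd)
      (Quotient.mk (identifyEnds s(i, j))) ⟨(i, j), hij⟩ where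
  ne := hij.ne
  eq_iff a b := by
    rw [Quotient.eq]
    change (a = b ∨ (a ∈ s(i, j) ∧ b ∈ s(i, j))) ↔ _
    simp only [Sym2.mem_iff]
  push d := by
    by_cases h : Quotient.mk (identifyEnds s(i, j)) d.fst = Quotient.mk _ d.snd
    · exact Or.inl h
    · exact Or.inr ⟨⟨(_, _), h, d.fst, d.snd, rfl, rfl, d.adj⟩, rfl, rfl⟩
  lift d := by
    obtain ⟨-, a, b, ha, hb, hab⟩ := d.adj
    exact ⟨⟨(a, b), hab⟩, ha, hb⟩

end Contraction

theorem mainTheorem5 {V : Type*} [Finite V] (G : SimpleGraph V) (hG : G.IsBipartite)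
    (e : Sym2 V) (he : e ∈ G.edgeSet) :
    ∃ h h' : ℤ[X],
      IsHStarPolynomial (symmetricEdgePolytope G) h ∧
      IsHStarPolynomial (symmetricEdgePolytope (contractEdge G e)) h' ∧
      h = (X + 1) * h' := by
  classical
  have := Fintype.ofFinite V
  have := Fintype.ofFinite (Quotient (identifyEnds e))
  induction e using Sym2.ind with
  | _ i j =>
  have hc := isArcContraction_contractEdge (G := G) he
  obtain ⟨col⟩ := hG
  -- The two colours serve as a `0`/`1` potential, which changes by `±1` along every dart.
  have hp : ∀ d : G.Dart, Odd (((col d.fst : ℕ) : ℤ) - ((col d.snd : ℕ) : ℤ)) := by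
    intro d
    have hne : (col d.fst : ℕ) ≠ col d.snd := fun h => col.valid d.adj (Fin.ext h)
    have h1 := (col d.fst).isLt
    have h2 := (col d.snd).isLt
    rw [Int.odd_iff]
    omega
  obtain ⟨h', hh'⟩ := exists_polynomial_normSeries
    (fun d : (contractEdge G s(i, j)).Dart => d.fst) fun d => d.snd
  refine ⟨(X + 1) * h', h', ?_, ?_, rfl⟩
  -- The extra factor `1 - x` from the rank, one higher for `G`, cancels the denominator of `(1 +
  -- x)/(1 - x)`.
  · rw [IsHStarPolynomial, one_sub_X_pow_mul_ehrhartSeries, hc.finrank_range,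
      hc.normSeries_eq (dartReverse G) (fun d => ⟨rfl, rfl⟩) (p := fun v => ((col v : ℕ) : ℤ)) hp,
      pow_succ, mul_mul_mul_comm, hh', one_sub_X_mul_mk_ncard_natAbs, Polynomial.coe_mul,
      Polynomial.coe_add, Polynomial.coe_X, Polynomial.coe_one]
    ring
  · rw [IsHStarPolynomial, one_sub_X_pow_mul_ehrhartSeries, hh']
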